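/- Let $H$ be a finite-dimensional complex Hilbert space and let $S$ be a linear operator on $H$ whose numerical radius $w(S)=\sup\{|\langle S\xi,\xi\rangle| : \xi\in H,\ \|\xi\|=1\}$ satisfies $w(S)\le 1$ (where $w(S)=0$ if $H=\{0\}$). Then for every $d\in\mathbb N$ there exist a finite-dimensional complex Hilbert space $K$ containing $H$ as a subspace and a unitary operator $U$ on $K$ such that $$S^k = 2\,P_H U^k|_H \qquad\text{for all } k=1,\dots,d,$$ where $P_H$ denotes the orthogonal projection of $K$ onto $H$. -/

import Mathlib

universe u

/-- The (classical) numerical radius of a bounded operator `S` on a complex inner product space: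
`w(S) = sup { |⟨Sξ, ξ⟩| : ‖ξ‖ = 1 }`. (It is `0` on the zero space.) -/
noncomputable def numericalRadius {H : Type*} [NormedAddCommGroup H] [InnerProductSpace ℂ H]
    (S : H →L[ℂ] H) : ℝ :=
  sSup {r : ℝ | ∃ ξ : H, ‖ξ‖ = 1 ∧ r = ‖inner ℂ (S ξ) ξ‖}

/-- The set in the definition of the numerical radius is bounded above by `‖S‖`, so the supremum
is a genuine one. -/
theorem numericalRadius_bddAbove {H : Type*} [NormedAddCommGroup H] [InnerProductSpace ℂ H]
    (S : H →L[ℂ] H) : BddAbove {r : ℝ | ∃ ξ : H, ‖ξ‖ = 1 ∧ r = ‖inner ℂ (S ξ) ξ‖} := by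
  refine ⟨‖S‖, ?_⟩
  rintro r ⟨ξ, hξ, rfl⟩
  calc ‖inner ℂ (S ξ) ξ‖ ≤ ‖S ξ‖ * ‖ξ‖ := norm_inner_le_norm _ _
    _ ≤ ‖S‖ := by simpa [hξ] using S.le_opNorm ξ

/-! A dilation amounts to vectors `e j ξ`, playing the role of `U ^ j ξ`, whose Gram matrix is the
block Toeplitz kernel `toeplitzForm`, so the point is positivity of that kernel. Let `N` be
`shiftTensor S d`. A discrete Fourier transform turns the shift into unimodular scalars, so `w(S) ≤
1` gives `Re N ≤ 1` (`re_sum_inner_shift_le`). As `N` is nilpotent, `1 - N` is invertible, and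
conjugating `Re (1 - N)` by its inverse yields the kernel (`exists_toeplitzForm_eq_inner`).

Toeplitz invariance makes `e j ξ ↦ e (j + 1) ξ` isometric on a span, and finite dimension extends it
to a unitary. Off the diagonal only one half of the kernel survives, which is the source of the
factor 2. -/

theorem norm_inner_apply_self_le_of_numericalRadius_le_one {H : Type*} [NormedAddCommGroup H]
    [InnerProductSpace ℂ H] {S : H →L[ℂ] H} (hS : numericalRadius S ≤ 1) (x : H) :
    ‖inner ℂ (S x) x‖ ≤ ‖x‖ ^ 2 := by
  rcases eq_or_ne x 0 with rfl | hx
  · simp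
  have hx' : ‖x‖ ≠ 0 := norm_ne_zero_iff.mpr hx
  have h1 : ‖inner ℂ (S ((‖x‖⁻¹ : ℂ) • x)) ((‖x‖⁻¹ : ℂ) • x)‖ ≤ 1 := by
    refine le_trans (le_csSup (numericalRadius_bddAbove S) ⟨(‖x‖⁻¹ : ℂ) • x, ?_, rfl⟩) hS
    rw [norm_smul]
    simp [hx']
  rw [map_smul, inner_smul_left, inner_smul_right, norm_mul, norm_mul] at h1
  simp only [map_inv₀, Complex.conj_ofReal, norm_inv, Complex.norm_real, norm_norm] at h1
  have hpos : 0 < ‖x‖ := norm_pos_iff.mpr hx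
  rw [← mul_assoc, ← mul_inv, ← pow_two, inv_mul_le_iff₀ (by positivity), mul_one] at h1
  exact h1

/-! ### Finite Fourier analysis and the shift estimate -/

/-- Orthogonality of the characters of a finite cyclic group. -/
theorem IsPrimitiveRoot.sum_conj_pow_mul_pow {ω : ℂ} {M : ℕ} (hω : IsPrimitiveRoot ω M)
    (hM : M ≠ 0) {p q : ℕ} (hp : p < M) (hq : q < M) :
    ∑ m ∈ Finset.range M, (starRingEnd ℂ) (ω ^ (m * p)) * ω ^ (m * q) =
      if p = q then (M : ℂ) else 0 := by
  have hconj : (starRingEnd ℂ) ω * ω = 1 := by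
    rw [mul_comm, Complex.mul_conj, Complex.normSq_eq_norm_sq, hω.norm'_eq_one hM]
    simp
  have hterm : ∀ m : ℕ, (starRingEnd ℂ) (ω ^ (m * p)) * ω ^ (m * q) =
      ((starRingEnd ℂ) ω ^ p * ω ^ q) ^ m := by
    intro m
    rw [map_pow, mul_pow, ← pow_mul, ← pow_mul, mul_comm p, mul_comm q]
  simp only [hterm]
  have hpp : (starRingEnd ℂ) ω ^ p * ω ^ p = 1 := by rw [← mul_pow, hconj, one_pow]
  split_ifs with h
  · subst h
    simp [hpp]
  · have hx1 : (starRingEnd ℂ) ω ^ p * ω ^ q - 1 ≠ 0 := by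
      intro h0
      apply h
      apply hω.pow_inj hp hq
      calc ω ^ p = ω ^ p * ((starRingEnd ℂ) ω ^ p * ω ^ q) := by rw [sub_eq_zero.mp h0, mul_one]
        _ = ((starRingEnd ℂ) ω ^ p * ω ^ p) * ω ^ q := by ring
        _ = ω ^ q := by rw [hpp, one_mul]
    apply (mul_eq_zero.mp ?_).resolve_right hx1
    rw [geom_sum_mul, mul_pow, ← pow_mul, ← pow_mul, mul_comm p, mul_comm q, pow_mul, pow_mul,
      ← map_pow, hω.pow_eq_one]
    simp

/-- Parseval's identity for the discrete Fourier transform of vector-valued sequences. -/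
theorem IsPrimitiveRoot.sum_inner_dft {H : Type*} [NormedAddCommGroup H] [InnerProductSpace ℂ H]
    {ω : ℂ} {M : ℕ} (hω : IsPrimitiveRoot ω M) (hM : M ≠ 0) (a b : ℕ → H) :
    ∑ m ∈ Finset.range M, inner ℂ (∑ p ∈ Finset.range M, ω ^ (m * p) • a p)
        (∑ q ∈ Finset.range M, ω ^ (m * q) • b q) =
      M * ∑ p ∈ Finset.range M, inner ℂ (a p) (b p) := by
  simp only [sum_inner, inner_sum, inner_smul_left, inner_smul_right]
  rw [Finset.sum_comm, Finset.mul_sum]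
  refine Finset.sum_congr rfl fun p hp => ?_
  simp only [Finset.mul_sum]
  rw [Finset.sum_comm]
  have : ∀ q ∈ Finset.range M, ∑ m ∈ Finset.range M,
      ω ^ (m * p) * ((starRingEnd ℂ) (ω ^ (m * q)) * inner ℂ (a q) (b p)) =
      if q = p then (M : ℂ) * inner ℂ (a p) (b p) else 0 := by
    intro q hq
    simp only [mul_left_comm (ω ^ _)]
    simp only [← mul_assoc]
    rw [← Finset.sum_mul, hω.sum_conj_pow_mul_pow hM (Finset.mem_range.mp hq)
      (Finset.mem_range.mp hp)]
    split_ifs with h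
    · rw [h]
    · simp
  rw [Finset.sum_congr rfl this, Finset.sum_ite_eq' _ p, if_pos hp]

/-- The numerical radius does not increase under tensoring with a truncated shift. -/
theorem re_sum_inner_shift_le {H : Type*} [NormedAddCommGroup H] [InnerProductSpace ℂ H]
    {S : H →L[ℂ] H} (hS : numericalRadius S ≤ 1) (d : ℕ) (g : ℕ → H) :
    (∑ i ∈ Finset.range d, inner ℂ (S (g (i + 1))) (g i)).re ≤
      ∑ i ∈ Finset.range (d + 1), ‖g i‖ ^ 2 := by
  -- Order `d + 2`, one more than the number of entries, leaves room to shift by one without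
  -- wrapping around.
  obtain ⟨ω, hω⟩ : ∃ ω : ℂ, IsPrimitiveRoot ω (d + 2) :=
    ⟨_, Complex.isPrimitiveRoot_exp (d + 2) (by omega)⟩
  have hM : d + 2 ≠ 0 := by omega
  set c : ℕ → H := fun p => if p < d + 1 then g p else 0 with hc
  obtain ⟨b, hb0, hb⟩ : ∃ b : ℕ → H, b 0 = 0 ∧ ∀ p, b (p + 1) = g p :=
    ⟨fun p => Nat.casesOn p 0 g, rfl, fun _ => rfl⟩
  set G : ℕ → H := fun m => ∑ p ∈ Finset.range (d + 1), ω ^ (m * p) • g p with hG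
  have hcG : ∀ m, ∑ p ∈ Finset.range (d + 2), ω ^ (m * p) • c p = G m := by
    intro m
    rw [Finset.sum_range_succ]
    simp only [hc, hG, lt_irrefl, if_false, smul_zero, add_zero]
    exact Finset.sum_congr rfl fun p hp => by rw [if_pos (Finset.mem_range.mp hp)]
  have hSG : ∀ m, ∑ p ∈ Finset.range (d + 2), ω ^ (m * p) • S (c p) = S (G m) := by
    intro m
    rw [← hcG, map_sum]
    simp
  have hbG : ∀ m, ∑ p ∈ Finset.range (d + 2), ω ^ (m * p) • b p = ω ^ m • G m := by
    intro m
    rw [Finset.sum_range_succ']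
    simp only [hb0, hb, hG, smul_zero, add_zero, Finset.smul_sum, smul_smul]
    exact Finset.sum_congr rfl fun p _ => by rw [← pow_add]; congr 2; ring
  have h1 := hω.sum_inner_dft hM (fun p => S (c p)) b
  have h2 := hω.sum_inner_dft hM c c
  simp only [hSG, hbG, hcG] at h1 h2
  have h1' : ∑ p ∈ Finset.range (d + 2), inner ℂ (S (c p)) (b p) =
      ∑ i ∈ Finset.range d, inner ℂ (S (g (i + 1))) (g i) := by
    rw [Finset.sum_range_succ', Finset.sum_range_succ]
    simp only [hc, hb0, hb, inner_zero_right, add_zero, lt_irrefl, if_false, map_zero, inner_zero_left]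
    exact Finset.sum_congr rfl fun p hp => by
      rw [if_pos (Nat.succ_lt_succ (Finset.mem_range.mp hp))]
  have h2' : ∑ p ∈ Finset.range (d + 2), inner ℂ (c p) (c p) =
      ((∑ i ∈ Finset.range (d + 1), ‖g i‖ ^ 2 : ℝ) : ℂ) := by
    rw [Finset.sum_range_succ, Complex.ofReal_sum]
    simp only [hc, lt_irrefl, if_false, inner_zero_right, add_zero]
    exact Finset.sum_congr rfl fun p hp => by
      rw [if_pos (Finset.mem_range.mp hp), inner_self_eq_norm_sq_to_K]
      simp
  rw [h1'] at h1
  rw [h2'] at h2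
  have key : (∑ m ∈ Finset.range (d + 2), inner ℂ (S (G m)) (ω ^ m • G m)).re ≤
      (∑ m ∈ Finset.range (d + 2), inner ℂ (G m) (G m)).re := by
    rw [Complex.re_sum, Complex.re_sum]
    -- The shift has become the phase `ω ^ m`, which disappears under the norm.
    refine Finset.sum_le_sum fun m _ => ?_
    calc (inner ℂ (S (G m)) (ω ^ m • G m)).re ≤ ‖inner ℂ (S (G m)) (ω ^ m • G m)‖ :=
          Complex.re_le_norm _
      _ = ‖inner ℂ (S (G m)) (G m)‖ := by
          rw [inner_smul_right, norm_mul, norm_pow, hω.norm'_eq_one hM, one_pow, one_mul]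
      _ ≤ ‖G m‖ ^ 2 := norm_inner_apply_self_le_of_numericalRadius_le_one hS _
      _ = (inner ℂ (G m) (G m)).re := (inner_self_eq_norm_sq (𝕜 := ℂ) (G m)).symm
  rw [h1, h2, ← Complex.ofReal_natCast, Complex.re_ofReal_mul, Complex.re_ofReal_mul,
    Complex.ofReal_re] at key
  exact le_of_mul_le_mul_left key (by positivity)

/-- The tensor product of an operator with the truncated backward shift. -/
noncomputable def shiftTensor {H : Type*} [NormedAddCommGroup H] [InnerProductSpace ℂ H]
    [FiniteDimensional ℂ H] (S : H →L[ℂ] H) (d : ℕ) :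
    PiLp 2 (fun _ : Fin (d + 1) => H) →L[ℂ] PiLp 2 (fun _ : Fin (d + 1) => H) :=
  LinearMap.toContinuousLinearMap
    { toFun := fun g => WithLp.toLp 2 fun i =>
        if h : (i : ℕ) + 1 < d + 1 then S (g ⟨i + 1, h⟩) else 0
      map_add' := fun g g' => by
        ext i
        by_cases h : (i : ℕ) < d <;> simp [h]
      map_smul' := fun c g => by
        ext i
        by_cases h : (i : ℕ) < d <;> simp [h] }

theorem shiftTensor_apply {H : Type*} [NormedAddCommGroup H] [InnerProductSpace ℂ H]
    [FiniteDimensional ℂ H] (S : H →L[ℂ] H) (d : ℕ) (g : PiLp 2 (fun _ : Fin (d + 1) => H))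
    (i : Fin (d + 1)) :
    shiftTensor S d g i = if h : (i : ℕ) + 1 < d + 1 then S (g ⟨i + 1, h⟩) else 0 := rfl

theorem re_inner_shiftTensor_le {H : Type*} [NormedAddCommGroup H] [InnerProductSpace ℂ H]
    [FiniteDimensional ℂ H] {S : H →L[ℂ] H} (hS : numericalRadius S ≤ 1) (d : ℕ)
    (g : PiLp 2 (fun _ : Fin (d + 1) => H)) :
    (inner ℂ (shiftTensor S d g) g).re ≤ ‖g‖ ^ 2 := by
  set c : ℕ → H := fun p => if h : p < d + 1 then g ⟨p, h⟩ else 0 with hc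
  have hgc : ∀ i : Fin (d + 1), g i = c i := fun i => by
    simp only [hc, i.isLt, dif_pos, Fin.eta]
  have h := re_sum_inner_shift_le hS d c
  rw [PiLp.norm_sq_eq_of_L2, PiLp.inner_apply]
  have h1 : ∀ i : Fin (d + 1), inner ℂ (shiftTensor S d g i) (g i) =
      inner ℂ (S (c (i + 1))) (c i) := by
    intro i
    rw [shiftTensor_apply, hgc]
    by_cases hi : (i : ℕ) < d <;> simp [hc, hi]
  simp only [h1]
  simp only [hgc]
  rw [← Finset.sum_range (fun i => inner ℂ (S (c (i + 1))) (c i)),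
    ← Finset.sum_range (fun i => ‖c i‖ ^ 2), Finset.sum_range_succ (n := d)]
  simpa [hc] using h

/-! ### Positivity of the Toeplitz kernel -/

/-- A Gram factorization of the real part of `1 - A`. -/
theorem exists_inner_eq_re_one_sub {E : Type*} [NormedAddCommGroup E] [InnerProductSpace ℂ E]
    [CompleteSpace E] (A : E →L[ℂ] E) (hA : ∀ g, (inner ℂ (A g) g).re ≤ ‖g‖ ^ 2) :
    ∃ B : E →L[ℂ] E, ∀ g g', inner ℂ (B g) (B g') =
      (1 / 2 : ℂ) * (inner ℂ (g - A g) g' + inner ℂ g (g' - A g')) := by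
  set P : E →L[ℂ] E := 1 - (1 / 2 : ℂ) • (A + star A) with hP
  have hin : ∀ g g', inner ℂ (P g) g' =
      (1 / 2 : ℂ) * (inner ℂ (g - A g) g' + inner ℂ g (g' - A g')) := by
    intro g g'
    simp only [hP, sub_apply, one_apply_eq_self,
      smul_apply, add_apply, inner_sub_left,
      inner_sub_right, inner_smul_left, inner_add_left, ContinuousLinearMap.star_eq_adjoint,
      ContinuousLinearMap.adjoint_inner_left]
    simp only [map_div₀, map_one, Complex.conj_ofNat]
    ring
  have hpos : 0 ≤ P := by
    rw [ContinuousLinearMap.nonneg_iff_isPositive, ContinuousLinearMap.isPositive_def']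
    refine ⟨?_, fun g => ?_⟩
    · rw [IsSelfAdjoint, hP]
      simp [add_comm]
    · rw [ContinuousLinearMap.reApplyInnerSelf_apply, hin]
      have h1 := hA g
      have h2 : (inner ℂ g (A g)).re = (inner ℂ (A g) g).re := inner_re_symm (𝕜 := ℂ) g (A g)
      have h3 : (inner ℂ g g).re = ‖g‖ ^ 2 := inner_self_eq_norm_sq (𝕜 := ℂ) g
      rw [inner_sub_left, inner_sub_right]
      simp only [RCLike.re_eq_complex_re, Complex.mul_re, Complex.add_re, Complex.sub_re, h2, h3]
      norm_num
      linarith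
  obtain ⟨B, hB⟩ := CStarAlgebra.nonneg_iff_eq_star_mul_self.mp hpos
  refine ⟨B, fun g g' => ?_⟩
  rw [← hin, hB, mul_apply_eq_comp, ContinuousLinearMap.star_eq_adjoint,
    ContinuousLinearMap.adjoint_inner_left]

/-- The column `(S ^ j, …, S, 1, 0, …, 0)`, which inverts `1 - shiftTensor S d` on the `j`-th
coordinate vectors. -/
noncomputable def powColumn {H : Type*} [NormedAddCommGroup H] [InnerProductSpace ℂ H]
    (S : H →L[ℂ] H) (d j : ℕ) : H →ₗ[ℂ] PiLp 2 (fun _ : Fin (d + 1) => H) where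
  toFun ξ := WithLp.toLp 2 fun i => if (i : ℕ) ≤ j then (S ^ (j - i)) ξ else 0
  map_add' ξ η := by
    ext i
    by_cases h : (i : ℕ) ≤ j <;> simp [h]
  map_smul' c ξ := by
    ext i
    by_cases h : (i : ℕ) ≤ j <;> simp [h]

theorem powColumn_apply {H : Type*} [NormedAddCommGroup H] [InnerProductSpace ℂ H]
    (S : H →L[ℂ] H) (d j : ℕ) (ξ : H) (i : Fin (d + 1)) :
    powColumn S d j ξ i = if (i : ℕ) ≤ j then (S ^ (j - i)) ξ else 0 := rfl

theorem powColumn_sub_shiftTensor {H : Type*} [NormedAddCommGroup H] [InnerProductSpace ℂ H]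
    [FiniteDimensional ℂ H] (S : H →L[ℂ] H) {d j : ℕ} (hj : j < d + 1) (ξ : H) (i : Fin (d + 1)) :
    (powColumn S d j ξ - shiftTensor S d (powColumn S d j ξ)) i =
      if i = ⟨j, hj⟩ then ξ else 0 := by
  rw [PiLp.sub_apply, shiftTensor_apply, powColumn_apply]
  simp only [powColumn_apply, Fin.ext_iff]
  rcases lt_trichotomy (i : ℕ) j with h | h | h
  · obtain ⟨n, rfl⟩ : ∃ n, j = i + 1 + n := ⟨j - (i + 1), by omega⟩
    rw [if_pos (by omega), dif_pos (by omega), if_pos (by omega), if_neg (by omega),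
      show (i : ℕ) + 1 + n - i = n + 1 by omega, show (i : ℕ) + 1 + n - (i + 1) = n by omega,
      pow_succ', mul_apply_eq_comp, sub_self]
  · subst h
    simp
  · have h1 : ¬ (i : ℕ) ≤ j := by omega
    have h2 : ¬ (i : ℕ) + 1 ≤ j := by omega
    have h3 : (i : ℕ) ≠ j := by omega
    simp [h1, h2, h3]

/-- The block Toeplitz kernel with symbol `1 + ∑ (zᵏ Sᵏ + z⁻ᵏ S⋆ᵏ) / 2`, in sesquilinear form. -/
noncomputable def toeplitzForm {H : Type*} [NormedAddCommGroup H] [InnerProductSpace ℂ H]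
    (S : H →L[ℂ] H) (j k : ℕ) (ξ η : H) : ℂ :=
  (1 / 2 : ℂ) * ((if j ≤ k then inner ℂ ξ ((S ^ (k - j)) η) else 0) +
    (if k ≤ j then inner ℂ ((S ^ (j - k)) ξ) η else 0))

/-- Factor `Re (1 - N)` as `B⋆ B` and put `e j = B ∘ powColumn S d j`. Since `1 - N` sends the
columns to coordinate vectors, each half of the Gram form just reads off one entry of a column. -/
theorem exists_toeplitzForm_eq_inner {H : Type*} [NormedAddCommGroup H] [InnerProductSpace ℂ H]
    [FiniteDimensional ℂ H] {S : H →L[ℂ] H} (hS : numericalRadius S ≤ 1) (d : ℕ) :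
    ∃ e : ℕ → H →ₗ[ℂ] PiLp 2 (fun _ : Fin (d + 1) => H), ∀ j k, j ≤ d → k ≤ d → ∀ ξ η,
      inner ℂ (e j ξ) (e k η) = toeplitzForm S j k ξ η := by
  obtain ⟨B, hB⟩ := exists_inner_eq_re_one_sub (shiftTensor S d) (re_inner_shiftTensor_le hS d)
  refine ⟨fun j => B.toLinearMap ∘ₗ powColumn S d j, fun j k hj hk ξ η => ?_⟩
  have hj' : j < d + 1 := by omega
  have hk' : k < d + 1 := by omega
  have h1 : ∀ x : PiLp 2 (fun _ : Fin (d + 1) => H), inner ℂ (powColumn S d j ξ -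
      shiftTensor S d (powColumn S d j ξ)) x = inner ℂ ξ (x ⟨j, hj'⟩) := by
    intro x
    rw [PiLp.inner_apply, Finset.sum_eq_single ⟨j, hj'⟩]
    · rw [powColumn_sub_shiftTensor S hj', if_pos rfl]
    · intro i _ hi
      rw [powColumn_sub_shiftTensor S hj', if_neg hi, inner_zero_left]
    · simp
  have h2 : ∀ x : PiLp 2 (fun _ : Fin (d + 1) => H), inner ℂ x (powColumn S d k η -
      shiftTensor S d (powColumn S d k η)) = inner ℂ (x ⟨k, hk'⟩) η := by
    intro x
    rw [PiLp.inner_apply, Finset.sum_eq_single ⟨k, hk'⟩]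
    · rw [powColumn_sub_shiftTensor S hk', if_pos rfl]
    · intro i _ hi
      rw [powColumn_sub_shiftTensor S hk', if_neg hi, inner_zero_right]
    · simp
  change inner ℂ (B (powColumn S d j ξ)) (B (powColumn S d k η)) = _
  rw [hB, h1, h2, powColumn_apply, powColumn_apply, toeplitzForm]
  congr 2
  · split_ifs <;> simp
  · split_ifs <;> simp

theorem toeplitzForm_succ {H : Type*} [NormedAddCommGroup H] [InnerProductSpace ℂ H]
    (S : H →L[ℂ] H) (j k : ℕ) (ξ η : H) :
    toeplitzForm S (j + 1) (k + 1) ξ η = toeplitzForm S j k ξ η := by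
  simp [toeplitzForm]

/-! ### Construction of the unitary -/

/-- Two families of vectors with the same Gram matrix differ by an isometry. -/
theorem exists_linearIsometryEquiv_comp_eq {F K : Type*} [AddCommGroup F] [Module ℂ F]
    [NormedAddCommGroup K] [InnerProductSpace ℂ K] [FiniteDimensional ℂ K] (A B : F →ₗ[ℂ] K)
    (h : ∀ x, ‖B x‖ = ‖A x‖) : ∃ U : K ≃ₗᵢ[ℂ] K, ∀ x, U (A x) = B x := by
  -- The choice of section `r` is harmless: equality of norms forces `ker A ≤ ker B`.
  obtain ⟨r, hr⟩ := A.rangeRestrict.exists_rightInverse_of_surjective A.range_rangeRestrict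
  have hr' : ∀ y : LinearMap.range A, A (r y) = y := fun y =>
    congrArg Subtype.val (LinearMap.congr_fun hr y)
  let C : LinearMap.range A →ₗᵢ[ℂ] K :=
    { toLinearMap := B ∘ₗ r
      norm_map' := fun y => by
        rw [LinearMap.comp_apply, h, hr']
        rfl }
  refine ⟨C.extend.toLinearIsometryEquiv rfl, fun x => ?_⟩
  have h1 : C.extend (A x) = C ⟨A x, x, rfl⟩ := C.extend_apply ⟨A x, x, rfl⟩
  have h2 : B (r ⟨A x, x, rfl⟩) = B x := by
    rw [← sub_eq_zero, ← map_sub, ← norm_eq_zero, h, map_sub, hr', sub_self, norm_zero]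
  rw [LinearIsometry.coe_toLinearIsometryEquiv, h1]
  exact h2

/-- The inclusion of `H` as a subspace of `K` is the isometric embedding `V`; the orthogonal
projection of `K` onto (the copy of) `H` is `(LinearMap.range V.toLinearMap).starProjection`. -/
theorem corollary3p3 {H : Type u} [NormedAddCommGroup H] [InnerProductSpace ℂ H]
    [FiniteDimensional ℂ H] (S : H →L[ℂ] H) (hS : numericalRadius S ≤ 1) (d : ℕ) :
    ∃ (K : Type u) (_ : NormedAddCommGroup K) (_ : InnerProductSpace ℂ K) (_ : CompleteSpace K)
      (_ : FiniteDimensional ℂ K) (V : H →ₗᵢ[ℂ] K),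
      ∃ U ∈ unitary (K →L[ℂ] K), ∀ k : ℕ, 1 ≤ k → k ≤ d → ∀ ξ : H,
        V ((S ^ k) ξ) =
          (2 : ℂ) • (LinearMap.range V.toLinearMap).starProjection ((U ^ k) (V ξ)) := by
  obtain ⟨e, he⟩ := exists_toeplitzForm_eq_inner hS d
  let V : H →ₗᵢ[ℂ] PiLp 2 (fun _ : Fin (d + 1) => H) := (e 0).isometryOfInner fun ξ η => by
    rw [he 0 0 d.zero_le d.zero_le]
    simp [toeplitzForm]
    ring
  have hV : ∀ ξ, V ξ = e 0 ξ := fun _ => rfl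
  -- Only indices below `d` are used, so that the shifted family stays within the range where the
  -- Gram matrix is known.
  let A : (Fin d → H) →ₗ[ℂ] PiLp 2 (fun _ : Fin (d + 1) => H) :=
    ∑ i : Fin d, e i ∘ₗ LinearMap.proj i
  let A' : (Fin d → H) →ₗ[ℂ] PiLp 2 (fun _ : Fin (d + 1) => H) :=
    ∑ i : Fin d, e (i + 1) ∘ₗ LinearMap.proj i
  have hA : ∀ x, A x = ∑ i : Fin d, e i (x i) := fun x => by simp [A]
  have hA' : ∀ x, A' x = ∑ i : Fin d, e (i + 1) (x i) := fun x => by simp [A']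
  obtain ⟨U, hU⟩ := exists_linearIsometryEquiv_comp_eq A A' fun x => by
    have : (inner ℂ (A' x) (A' x)) = (inner ℂ (A x) (A x)) := by
      rw [hA, hA']
      simp only [sum_inner, inner_sum]
      refine Finset.sum_congr rfl fun i _ => Finset.sum_congr rfl fun j _ => ?_
      rw [he _ _ (by omega) (by omega), he _ _ (by omega) (by omega), toeplitzForm_succ]
    rw [@norm_eq_sqrt_re_inner ℂ, @norm_eq_sqrt_re_inner ℂ, this]
  have hUe : ∀ j, j < d → ∀ ξ, U (e j ξ) = e (j + 1) ξ := by
    intro j hj ξ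
    have h := hU (Pi.single ⟨j, hj⟩ ξ)
    rw [hA, hA', Finset.sum_eq_single ⟨j, hj⟩, Finset.sum_eq_single ⟨j, hj⟩] at h
    · simpa using h
    · intro i _ hi
      simp [Pi.single_eq_of_ne hi]
    · simp
    · intro i _ hi
      simp [Pi.single_eq_of_ne hi]
    · simp
  refine ⟨PiLp 2 (fun _ : Fin (d + 1) => H), inferInstance, inferInstance, inferInstance,
    inferInstance, V, _, (Unitary.linearIsometryEquiv.symm U).2, fun k hk hkd ξ => ?_⟩
  set W := ((Unitary.linearIsometryEquiv.symm U : unitary (_ →L[ℂ] _)) :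
    PiLp 2 (fun _ : Fin (d + 1) => H) →L[ℂ] PiLp 2 (fun _ : Fin (d + 1) => H)) with hW
  have hWU : ∀ x, W x = U x := fun x => by simp [hW]
  have hpow : ∀ j, j ≤ d → (W ^ j) (V ξ) = e j ξ := by
    intro j
    induction j with
    | zero => intro _; simp [hV]
    | succ j ih =>
      intro hj
      rw [pow_succ', mul_apply_eq_comp, ih (by omega), hWU, hUe j (by omega)]
  have hproj : (LinearMap.range V.toLinearMap).starProjection ((W ^ k) (V ξ)) =
      V ((1 / 2 : ℂ) • (S ^ k) ξ) := by
    apply Submodule.eq_starProjection_of_mem_of_inner_eq_zero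
    · exact ⟨_, rfl⟩
    · rintro _ ⟨η, rfl⟩
      -- For `k ≠ 0` the condition `k ≤ 0` fails and one half of the kernel drops out.
      have hk0 : k ≠ 0 := by omega
      have : inner ℂ (e k ξ) (e 0 η) = (1 / 2 : ℂ) * inner ℂ ((S ^ k) ξ) η := by
        rw [he k 0 hkd d.zero_le]
        simp [toeplitzForm, hk0]
      change inner ℂ (_ - _) (V η) = 0
      rw [inner_sub_left, V.inner_map_map, hpow k hkd, hV, this, inner_smul_left, map_div₀, map_one,
        Complex.conj_ofNat, sub_self]
  rw [hproj, ← map_smul, smul_smul]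
  simp
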